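/- Let $E$ and $F$ be (real) Banach lattices, let $\mathcal S\subset E$ be norm bounded, let $sol(\mathcal S)=\{x\in E:\ |x|\le |y| \text{ for some } y\in\mathcal S\}$ be its solid hull, and let $T:E\to F$ be a bounded linear operator. A net $(x_\alpha)$ in a Banach lattice is uaw-convergent to $x$ if $|x_\alpha-x|\wedge u\to 0$ weakly for every $u\ge 0$ in that lattice. The operator $T$ is uaw-continuous if $Tx_\alpha$ is uaw-convergent to $Tx$ whenever $x_\alpha$ is uaw-convergent to $x$. A norm bounded set $A\subset E$ is uaw-compact (respectively relatively uaw-compact) if every net in $A$ has a subnet that is uaw-convergent to a point of $A$ (respectively to a point of $E$). The operator $T$ is $\mathcal S$-L-weakly compact if $\|Tx_n\|\to 0$ for every sequence $(x_n)$ in $sol(\mathcal S)$ that is uaw-convergent to $0$. If $T$ is uaw-continuous, then the following statements are equivalent: 1. $T$ is $\mathcal S$-L-weakly compact. 2. $T(A)$ is relatively compact (in norm) for every relatively uaw-compact subset $A\subset sol(\mathcal S)$. 3. $T(A)$ is compact (in norm) for every uaw-compact subset $A\subset sol(\mathcal S)$. Moreover, the implications $1\Rightarrow 2$ and $1\Rightarrow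 3$ hold without assuming that $T$ is uaw-continuous. -/

import Mathlib

open Filter Topology

/-- Unbounded absolute weak (uaw) convergence of `x` to `a` along the filter `l`:
`|x i - a| ⊓ u` converges weakly to `0` along `l`, for every `u ≥ 0`. For a net `x : ι → E`,
take `l = atTop`. -/
def UawTendsto {ι E : Type*} [NormedAddCommGroup E] [NormedSpace ℝ E] [Lattice E]
    (x : ι → E) (l : Filter ι) (a : E) : Prop :=
  ∀ u : E, 0 ≤ u → ∀ f : StrongDual ℝ E, Tendsto (fun i => f (|x i - a| ⊓ u)) l (𝓝 0)

/-- `T` preserves uaw-convergence. Nets are expressed by filters on `E`, as in Mathlib's treatment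
of continuity. -/
def UawContinuous {E F : Type*} [NormedAddCommGroup E] [NormedSpace ℝ E] [Lattice E]
    [NormedAddCommGroup F] [NormedSpace ℝ F] [Lattice F] (T : E →L[ℝ] F) : Prop :=
  ∀ (l : Filter E) (a : E), UawTendsto (fun x => x) l a → UawTendsto (fun x => T x) l (T a)

/-- A norm bounded set `A` is uaw-compact if every net in `A` has a subnet which is uaw-convergent
to a point of `A`. Nets in `A` are expressed by proper filters containing `A`, and subnets by
finer proper filters, as in Mathlib's treatment of compactness. -/
def IsUawCompact {E : Type*} [NormedAddCommGroup E] [NormedSpace ℝ E] [Lattice E]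
    (A : Set E) : Prop :=
  Bornology.IsBounded A ∧
    ∀ l : Filter E, l.NeBot → l ≤ 𝓟 A →
      ∃ l' : Filter E, l'.NeBot ∧ l' ≤ l ∧ ∃ a ∈ A, UawTendsto (fun x => x) l' a

/-- A norm bounded set `A` is relatively uaw-compact if every net in `A` has a subnet which is
uaw-convergent to some point of the whole space. -/
def IsRelUawCompact {E : Type*} [NormedAddCommGroup E] [NormedSpace ℝ E] [Lattice E]
    (A : Set E) : Prop :=
  Bornology.IsBounded A ∧
    ∀ l : Filter E, l.NeBot → l ≤ 𝓟 A →
      ∃ l' : Filter E, l'.NeBot ∧ l' ≤ l ∧ ∃ a : E, UawTendsto (fun x => x) l' a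

/-- `T` is `S`-L-weakly compact: `‖T (x n)‖ → 0` for every uaw-null sequence `x` in the solid hull
`{y | ∃ z ∈ S, |y| ≤ |z|}` of `S`. The notion is used for norm bounded `S`. -/
def IsLWeaklyCompactOn {E Y : Type*} [NormedAddCommGroup E] [NormedSpace ℝ E] [Lattice E]
    [NormedAddCommGroup Y] [NormedSpace ℝ Y] (S : Set E) (T : E →L[ℝ] Y) : Prop :=
  ∀ x : ℕ → E, (∀ n, x n ∈ LatticeOrderedAddCommGroup.solidClosure S) →
    UawTendsto x atTop 0 → Tendsto (fun n => T (x n)) atTop (𝓝 0)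

/-! Statement 1 speaks of sequences, 2 and 3 of nets; the core is
`IsLWeaklyCompactOn.tendsto_of_uawTendsto_zero`, which passes from one to the other. Up to ε, T sees
a positive x in sol(S) only through x ⊓ u for one fixed u (`exists_norm_map_posPart_sub_le`):
otherwise one builds a disjoint, hence uaw-null, sequence in sol(S) on which T stays large. On [0,
u], a weakly null net whose image is not norm null yields points x_n and positive functionals φ_n
dominated by T, with φ_n(x_n) ≥ ε and φ_m(x_n) tiny for m < n. Comparing suprema of successive tails
of (x_n) excludes this (`not_exists_biorthogonal`).

Hence T turns uaw-convergent filters on sol(S) into norm Cauchy filters, which gives 2, and into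
convergent ones if the uaw-limit lies in sol(S), which gives 3. Conversely, a uaw-null sequence in
sol(S) together with 0 is uaw-compact, so its image lies in a norm compact set, and uaw-continuity
forces every norm cluster point of the image sequence to be 0. -/

/-! ### Inequalities in lattice ordered groups. -/

section Group

variable {E : Type*} [AddCommGroup E] [Lattice E] [IsOrderedAddMonoid E]

/-- Riesz decomposition of an element whose absolute value is dominated by a sum. -/
theorem exists_add_eq_of_abs_le_add {y a b : E} (ha : 0 ≤ a) (hb : 0 ≤ b) (h : |y| ≤ a + b) :
    ∃ y₁ y₂ : E, y₁ + y₂ = y ∧ |y₁| ≤ a ∧ |y₂| ≤ b ∧ |y₁| ≤ |y| ∧ |y₂| ≤ |y| := by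
  have h1 : y ≤ a + b := (le_abs_self y).trans h
  have h2 : -y ≤ a + b := (neg_le_abs y).trans h
  have h3 : 0 ≤ |y| := abs_nonneg y
  have h4 : y ≤ |y| := le_abs_self y
  have h5 : -y ≤ |y| := neg_le_abs y
  -- The first summand is y clipped to [-a, a].
  refine ⟨(y ⊓ a) ⊔ (-a), y - ((y ⊓ a) ⊔ (-a)), add_sub_cancel _ _, ?_, ?_, ?_, ?_⟩
  · refine abs_le'.2 ⟨sup_le inf_le_right ((neg_nonpos.2 ha).trans ha), ?_⟩
    exact neg_le.1 le_sup_right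
  · refine abs_le'.2 ⟨?_, ?_⟩
    · rw [sub_le_iff_le_add, ← sub_le_iff_le_add']
      exact le_trans (le_inf (sub_le_self _ hb) (sub_le_iff_le_add.2 h1)) le_sup_left
    · rw [neg_sub, sub_le_iff_le_add]
      refine sup_le (inf_le_left.trans (le_add_of_nonneg_left hb)) ?_
      calc -a ≤ -(-y - b) := neg_le_neg (sub_le_iff_le_add.2 h2)
        _ = b + y := by abel
  · refine abs_le'.2 ⟨sup_le (inf_le_left.trans h4) ((neg_nonpos.2 ha).trans h3), ?_⟩
    refine neg_le.1 (le_trans (le_inf (neg_le.1 h5) ((neg_nonpos.2 h3).trans ha)) le_sup_left)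
  · refine abs_le'.2 ⟨?_, ?_⟩
    · rw [sub_le_iff_le_add, ← sub_le_iff_le_add']
      exact le_trans (le_inf (sub_le_self _ h3) ((sub_nonpos.2 h4).trans ha)) le_sup_left
    · rw [neg_sub, sub_le_iff_le_add]
      refine sup_le (inf_le_left.trans (le_add_of_nonneg_left h3)) ((neg_nonpos.2 ha).trans ?_)
      rw [add_comm]; exact neg_le_iff_add_nonneg'.1 h5

theorem inf_add_le_add_inf {a b c : E} (ha : 0 ≤ a) (hb : 0 ≤ b) (hc : 0 ≤ c) :
    (a + b) ⊓ c ≤ a ⊓ c + b ⊓ c := by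
  rw [add_inf, inf_add, inf_add]
  refine le_inf (le_inf inf_le_left ?_) (le_inf ?_ ?_)
  · exact inf_le_right.trans (le_add_of_nonneg_right hb)
  · exact inf_le_right.trans (le_add_of_nonneg_left ha)
  · exact inf_le_right.trans (le_add_of_nonneg_left hc)

/-- For disjoint positive elements sum and supremum coincide, and each d n ⊓ w lies below w. -/
theorem sum_inf_le_of_pairwise_inf_eq_zero {d : ℕ → E} (hd : ∀ n, 0 ≤ d n)
    (hdisj : ∀ m n, m < n → d m ⊓ d n = 0) {w : E} (hw : 0 ≤ w) (N : ℕ) :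
    ∑ n ∈ Finset.range N, d n ⊓ w ≤ w := by
  have key : ∀ N k, N ≤ k → (∑ n ∈ Finset.range N, d n ⊓ w) ⊓ d k = 0 := by
    intro N
    induction N with
    | zero => intro k _; simp [hd k]
    | succ N ih =>
      intro k hk
      have h0 : 0 ≤ ∑ n ∈ Finset.range N, d n ⊓ w :=
        Finset.sum_nonneg fun n _ => le_inf (hd n) hw
      refine le_antisymm ?_ (le_inf (Finset.sum_nonneg fun n _ => le_inf (hd n) hw) (hd k))
      rw [Finset.sum_range_succ]
      refine (inf_add_le_add_inf h0 (le_inf (hd N) hw) (hd k)).trans ?_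
      rw [ih k (by omega), zero_add]
      exact (inf_le_inf_right _ inf_le_left).trans (hdisj N k (by omega)).le
  induction N with
  | zero => simpa using hw
  | succ N ih =>
    rw [Finset.sum_range_succ]
    have h0 : (∑ n ∈ Finset.range N, d n ⊓ w) ⊓ (d N ⊓ w) = 0 := by
      refine le_antisymm ((inf_le_inf_left _ inf_le_left).trans (key N N le_rfl).le) ?_
      exact le_inf (Finset.sum_nonneg fun n _ => le_inf (hd n) hw) (le_inf (hd N) hw)
    rw [← inf_add_sup, h0, zero_add]
    exact sup_le ih inf_le_right

end Group

/-! ### The modulus of a continuous functional. -/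

section Modulus

variable {E : Type*} [NormedAddCommGroup E] [NormedSpace ℝ E] [Lattice E] [IsOrderedAddMonoid E]
  [HasSolidNorm E]

/-- Every continuous functional has a modulus. -/
theorem exists_modulus (f : StrongDual ℝ E) : ∃ g : StrongDual ℝ E,
    (∀ x y, |y| ≤ x → |f y| ≤ g x) ∧
      ∀ x c, 0 ≤ x → (∀ y, |y| ≤ x → f y ≤ c) → g x ≤ c := by
  let I : E → Set ℝ := fun x => f '' {y | |y| ≤ x}
  let h : E → ℝ := fun x => sSup (I x)
  have hbound : ∀ x, ∀ y, |y| ≤ x → f y ≤ ‖f‖ * ‖x‖ := fun x y hy => by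
    refine (le_abs_self _).trans ((f.le_opNorm y).trans ?_)
    gcongr
    exact norm_le_norm_of_abs_le_abs (hy.trans (le_abs_self x))
  have hbdd : ∀ x, BddAbove (I x) := fun x => by
    refine ⟨‖f‖ * ‖x‖, ?_⟩
    rintro _ ⟨y, hy, rfl⟩
    exact hbound x y hy
  have hne : ∀ x, 0 ≤ x → (I x).Nonempty := fun x hx => ⟨f 0, 0, by simpa using hx, rfl⟩
  have hle : ∀ x y, |y| ≤ x → f y ≤ h x := fun x y hy => le_csSup (hbdd x) ⟨y, hy, rfl⟩
  have hsup : ∀ x c, 0 ≤ x → (∀ y, |y| ≤ x → f y ≤ c) → h x ≤ c := fun x c hx hc => by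
    refine csSup_le (hne x hx) ?_
    rintro _ ⟨y, hy, rfl⟩
    exact hc y hy
  have h0 : ∀ x, 0 ≤ x → 0 ≤ h x := fun x hx => by
    simpa using hle x 0 (by simpa using hx)
  have hadd : ∀ x y, 0 ≤ x → 0 ≤ y → h (x + y) = h x + h y := by
    intro x y hx hy
    apply le_antisymm
    · refine hsup _ _ (add_nonneg hx hy) fun z hz => ?_
      obtain ⟨z₁, z₂, rfl, h1, h2, -, -⟩ := exists_add_eq_of_abs_le_add hx hy hz
      rw [map_add]
      exact add_le_add (hle _ _ h1) (hle _ _ h2)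
    · rw [← le_sub_iff_add_le]
      refine hsup _ _ hx fun a ha => ?_
      rw [le_sub_comm]
      refine hsup _ _ hy fun b hb => ?_
      rw [le_sub_iff_add_le, ← map_add, add_comm b a]
      exact hle _ _ ((abs_add_le a b).trans (add_le_add ha hb))
  have hdiff : ∀ a b c d : E, 0 ≤ a → 0 ≤ b → 0 ≤ c → 0 ≤ d → a - b = c - d →
      h a - h b = h c - h d := by
    intro a b c d ha hb hc hd e
    have e' : a + d = c + b := sub_eq_sub_iff_add_eq_add.1 e
    have := congrArg h e'
    rw [hadd _ _ ha hd, hadd _ _ hc hb] at this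
    linarith
  -- `h` is additive on the positive cone by Riesz decomposition, so it extends to differences.
  let g₀ : E →+ ℝ := AddMonoidHom.mk' (fun x => h x⁺ - h x⁻) fun x y => by
    have := hdiff (x + y)⁺ (x + y)⁻ (x⁺ + y⁺) (x⁻ + y⁻) (posPart_nonneg _) (negPart_nonneg _)
      (add_nonneg (posPart_nonneg _) (posPart_nonneg _))
      (add_nonneg (negPart_nonneg _) (negPart_nonneg _)) (by
        rw [posPart_sub_negPart, add_sub_add_comm, posPart_sub_negPart, posPart_sub_negPart])
    rw [hadd _ _ (posPart_nonneg _) (posPart_nonneg _),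
      hadd _ _ (negPart_nonneg _) (negPart_nonneg _)] at this
    linarith
  have hg₀ : ∀ x, 0 ≤ x → g₀ x = h x := fun x hx => by
    have := hdiff x⁺ x⁻ x 0 (posPart_nonneg _) (negPart_nonneg _) hx le_rfl (by simp)
    have h00 : h 0 = 0 := by have := hadd 0 0 le_rfl le_rfl; simp at this; exact this
    change h x⁺ - h x⁻ = h x
    rw [this, h00, sub_zero]
  have hcont : Continuous g₀ := by
    refine AddMonoidHomClass.continuous_of_bound g₀ ‖f‖ fun x => ?_
    change |h x⁺ - h x⁻| ≤ _
    have hb : ∀ z, 0 ≤ z → |z| ≤ |x| → h z ≤ ‖f‖ * ‖x‖ := fun z hz hzx => by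
      refine hsup z _ hz fun y hy => (hbound z y hy).trans ?_
      gcongr
      exact norm_le_norm_of_abs_le_abs hzx
    have e1 := hb x⁺ (posPart_nonneg _) (by
      rw [abs_of_nonneg (posPart_nonneg _)]
      exact sup_le (le_abs_self x) (abs_nonneg x))
    have e2 := hb x⁻ (negPart_nonneg _) (by
      rw [abs_of_nonneg (negPart_nonneg _)]
      exact sup_le (neg_le_abs x) (abs_nonneg x))
    have e3 := h0 x⁺ (posPart_nonneg _)
    have e4 := h0 x⁻ (negPart_nonneg _)
    rw [abs_le]
    constructor <;> linarith
  -- Continuous additive maps are real linear, so homogeneity needs no check.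
  refine ⟨g₀.toRealLinearMap hcont, fun x y hy => ?_, fun x c hx hc => ?_⟩
  · have hx : 0 ≤ x := (abs_nonneg y).trans hy
    change |f y| ≤ g₀ x
    rw [hg₀ x hx, abs_le]
    have := hle x y hy
    have := hle x (-y) (by rwa [abs_neg])
    rw [map_neg] at this
    constructor <;> linarith
  · change g₀ x ≤ c
    rw [hg₀ x hx]
    exact hsup x c hx hc

omit [HasSolidNorm E] in
theorem nonneg_of_forall_abs_le {f g : StrongDual ℝ E} (hg : ∀ x y, |y| ≤ x → |f y| ≤ g x)
    {x : E} (hx : 0 ≤ x) : 0 ≤ g x := by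
  simpa using hg x 0 (by simpa using hx)

omit [HasSolidNorm E] in
theorem mono_of_forall_abs_le {f g : StrongDual ℝ E} (hg : ∀ x y, |y| ≤ x → |f y| ≤ g x)
    {x y : E} (hxy : x ≤ y) : g x ≤ g y := by
  have := nonneg_of_forall_abs_le hg (sub_nonneg.2 hxy)
  rw [map_sub] at this
  linarith

end Modulus

/-! ### Calculus of uaw-convergence. -/

section Uaw

variable {E : Type*} [NormedAddCommGroup E] [NormedSpace ℝ E] [Lattice E]

theorem UawTendsto.comp {ι κ : Type*} {x : ι → E} {l : Filter ι} {a : E} (h : UawTendsto x l a)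
    {φ : κ → ι} {l' : Filter κ} (hφ : Tendsto φ l' l) : UawTendsto (fun k => x (φ k)) l' a :=
  fun u hu f => (h u hu f).comp hφ

theorem UawTendsto.sub_const {ι : Type*} {x : ι → E} {l : Filter ι} {a : E}
    (h : UawTendsto x l a) : UawTendsto (fun i => x i - a) l 0 := fun u hu f => by
  simpa using h u hu f

variable [IsOrderedAddMonoid E] [HasSolidNorm E]

theorem UawTendsto.of_abs_le {ι : Type*} {x y : ι → E} {l : Filter ι} (hx : UawTendsto x l 0)
    (h : ∀ᶠ i in l, |y i| ≤ |x i|) : UawTendsto y l 0 := by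
  intro u hu f
  obtain ⟨g, hg, -⟩ := exists_modulus f
  refine squeeze_zero_norm' ?_ (hx u hu g)
  filter_upwards [h] with i hi
  refine hg _ _ ?_
  rw [sub_zero, sub_zero, abs_of_nonneg (le_inf (abs_nonneg _) hu)]
  exact inf_le_inf_right _ hi

theorem UawTendsto.neg {ι : Type*} {x : ι → E} {l : Filter ι} (hx : UawTendsto x l 0) :
    UawTendsto (fun i => -x i) l 0 :=
  hx.of_abs_le (.of_forall fun _ => (abs_neg _).le)

theorem UawTendsto.add {ι : Type*} {x y : ι → E} {l : Filter ι} (hx : UawTendsto x l 0)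
    (hy : UawTendsto y l 0) : UawTendsto (fun i => x i + y i) l 0 := by
  intro u hu f
  obtain ⟨g, hg, -⟩ := exists_modulus f
  refine squeeze_zero_norm (fun i => ?_) (by simpa using (hx u hu g).add (hy u hu g))
  rw [← map_add]
  refine hg _ _ ?_
  rw [sub_zero, abs_of_nonneg (le_inf (abs_nonneg _) hu)]
  exact (inf_le_inf_right _ (abs_add_le _ _)).trans
    (inf_add_le_add_inf (abs_nonneg _) (abs_nonneg _) hu)

/-- A positive functional has bounded partial sums on d n ⊓ w, so its values there tend to 0. This
serves both telescoping increments and disjoint sequences. -/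
theorem uawTendsto_zero_of_sum_inf_le {d : ℕ → E} (hd : ∀ n, 0 ≤ d n)
    (h : ∀ w, 0 ≤ w → ∃ b, ∀ N, ∑ n ∈ Finset.range N, d n ⊓ w ≤ b) :
    UawTendsto d atTop 0 := by
  intro u hu f
  obtain ⟨g, hg, -⟩ := exists_modulus f
  obtain ⟨b, hb⟩ := h u hu
  have hs : Summable fun n => g (d n ⊓ u) := by
    refine summable_of_sum_range_le (c := g b)
      (fun n => nonneg_of_forall_abs_le hg (le_inf (hd n) hu)) fun N => ?_
    rw [← map_sum]
    exact mono_of_forall_abs_le hg (hb N)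
  refine squeeze_zero_norm (fun n => ?_) hs.tendsto_atTop_zero
  refine hg _ _ ?_
  rw [sub_zero, abs_of_nonneg (hd n), abs_of_nonneg (le_inf (hd n) hu)]

/-- Norm limits and uaw-limits agree. -/
theorem UawTendsto.eq_zero_of_tendsto {ι : Type*} {x : ι → E} {l : Filter ι} [l.NeBot] {b : E}
    (hx : UawTendsto x l 0) (hb : Tendsto x l (𝓝 b)) : b = 0 := by
  -- Truncating at u = |b| makes |x i| ⊓ u converge in norm to |b| itself.
  have hc : Continuous fun z : E => |z - 0| ⊓ |b| := by
    have : Continuous fun z : E => ((z - 0) ⊔ -(z - 0)) ⊓ |b| := by fun_prop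
    exact this
  have h : ∀ f : StrongDual ℝ E, f |b| = 0 := fun f => by
    have h1 := hx |b| (abs_nonneg b) f
    have h2 := ((f.continuous.comp hc).tendsto b).comp hb
    have := tendsto_nhds_unique h2 h1
    simpa using this
  have h3 : |b| = 0 := by
    by_contra hne
    obtain ⟨f, hf⟩ := SeparatingDual.exists_ne_zero (R := ℝ) hne
    exact hf (h f)
  have := norm_abs_eq_norm b
  rw [h3, norm_zero] at this
  exact norm_eq_zero.1 this.symm

end Uaw

/-! ### From sequences to nets inside an order interval. -/

section NullOnInterval

variable {E F : Type*} [NormedAddCommGroup E] [NormedSpace ℝ E] [Lattice E]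
  [IsOrderedAddMonoid E] [HasSolidNorm E] [NormedAddCommGroup F] [NormedSpace ℝ F]

/-- `T` maps uaw-null sequences in the order interval `[-u, u]` to norm-null sequences. -/
def NullOnInterval (T : E →L[ℝ] F) (u : E) : Prop :=
  ∀ y : ℕ → E, (∀ n, |y n| ≤ u) → UawTendsto y atTop 0 → Tendsto (fun n => T (y n)) atTop (𝓝 0)

/-- `T` has norm at most `c` on the order interval `[-z, z]`. -/
def BoundedOnInterval (T : E →L[ℝ] F) (z : E) (c : ℝ) : Prop := ∀ y, |y| ≤ z → ‖T y‖ ≤ c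

section BoundedOnInterval

variable {T : E →L[ℝ] F}

omit [IsOrderedAddMonoid E] [HasSolidNorm E] in
theorem BoundedOnInterval.mono {z z' : E} {c c' : ℝ} (h : BoundedOnInterval T z c) (hz : z' ≤ z)
    (hc : c ≤ c') : BoundedOnInterval T z' c' := fun y hy => (h y (hy.trans hz)).trans hc

omit [HasSolidNorm E] in
theorem BoundedOnInterval.zero : BoundedOnInterval T 0 0 := fun y hy => by
  have h1 : y ≤ 0 := (le_abs_self y).trans hy
  have h2 : 0 ≤ y := neg_nonpos.1 ((neg_le_abs y).trans hy)
  simp [le_antisymm h1 h2]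

omit [HasSolidNorm E] in
theorem BoundedOnInterval.add {z z' : E} {c c' : ℝ} (hz : 0 ≤ z) (hz' : 0 ≤ z')
    (h : BoundedOnInterval T z c) (h' : BoundedOnInterval T z' c') :
    BoundedOnInterval T (z + z') (c + c') := fun y hy => by
  obtain ⟨y₁, y₂, rfl, h1, h2, -, -⟩ := exists_add_eq_of_abs_le_add hz hz' hy
  rw [map_add]
  exact (norm_add_le _ _).trans (add_le_add (h _ h1) (h' _ h2))

omit [HasSolidNorm E] in
theorem BoundedOnInterval.sum {ι : Type*} (s : Finset ι) {z : ι → E} {c : ι → ℝ}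
    (hz : ∀ i ∈ s, 0 ≤ z i) (h : ∀ i ∈ s, BoundedOnInterval T (z i) (c i)) :
    BoundedOnInterval T (∑ i ∈ s, z i) (∑ i ∈ s, c i) := by
  classical
  induction s using Finset.induction_on with
  | empty => simpa using BoundedOnInterval.zero
  | insert i s hi ih =>
    rw [Finset.sum_insert hi, Finset.sum_insert hi]
    exact (h i (Finset.mem_insert_self _ _)).add (hz i (Finset.mem_insert_self _ _))
      (Finset.sum_nonneg fun j hj => hz j (Finset.mem_insert_of_mem hj))
      (ih (fun j hj => hz j (Finset.mem_insert_of_mem hj))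
        fun j hj => h j (Finset.mem_insert_of_mem hj))

end BoundedOnInterval

namespace NullOnInterval

variable {T : E →L[ℝ] F}

theorem add {u v : E} (hu : 0 ≤ u) (hv : 0 ≤ v) (h : NullOnInterval T u)
    (h' : NullOnInterval T v) : NullOnInterval T (u + v) := by
  intro y hy hy0
  choose y₁ y₂ hadd h1 h2 h3 h4 using fun n => exists_add_eq_of_abs_le_add hu hv (hy n)
  have e1 := h y₁ h1 (hy0.of_abs_le (.of_forall h3))
  have e2 := h' y₂ h2 (hy0.of_abs_le (.of_forall h4))
  have := e1.add e2
  simpa only [← map_add, hadd, add_zero] using this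

theorem nsmul {u : E} (hu : 0 ≤ u) (h : NullOnInterval T u) (k : ℕ) :
    NullOnInterval T (k • u) := by
  induction k with
  | zero =>
    intro y hy _
    have : ∀ n, T (y n) = 0 := fun n => by
      have := BoundedOnInterval.zero (T := T) (y n) (by simpa using hy n)
      exact norm_le_zero_iff.1 this
    simp [this]
  | succ k ih =>
    rw [succ_nsmul]
    exact ih.add (nsmul_nonneg hu k) hu h

/-- Eventual domination of the increments of a sequence in an order interval: `T` is small on
`[-(a M - a N), a M - a N]` for a suitable `N` and all `M ≥ N`. -/
theorem exists_forall_boundedOnInterval {u : E} (h : NullOnInterval T u) {a : ℕ → E}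
    (ha0 : ∀ n, 0 ≤ a n) (hau : ∀ n, a n ≤ u) {c : ℝ} (hc : 0 < c) :
    ∃ N, ∀ M, N ≤ M → BoundedOnInterval T (a M - a N) c := by
  by_contra! hcon
  choose M hM hMc using hcon
  let k : ℕ → ℕ := fun n => M^[n] 0
  have hk : ∀ n, k (n + 1) = M (k n) := fun n => Function.iterate_succ_apply' M n 0
  have hex : ∀ n, ∃ y, |y| ≤ a (k (n + 1)) - a (k n) ∧ c < ‖T y‖ := fun n => by
    have := hMc (k n)
    rw [← hk] at this
    simpa [BoundedOnInterval] using this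
  choose y hy hyc using hex
  have hd : ∀ n, 0 ≤ a (k (n + 1)) - a (k n) := fun n => (abs_nonneg _).trans (hy n)
  -- The increments are positive and telescope, so their sums stay below u.
  have hd0 : UawTendsto (fun n => a (k (n + 1)) - a (k n)) atTop 0 := by
    refine uawTendsto_zero_of_sum_inf_le hd fun w _ => ⟨u, fun N => ?_⟩
    calc ∑ n ∈ Finset.range N, (a (k (n + 1)) - a (k n)) ⊓ w
        ≤ ∑ n ∈ Finset.range N, (a (k (n + 1)) - a (k n)) :=
          Finset.sum_le_sum fun n _ => inf_le_left
      _ = a (k N) - a (k 0) := Finset.sum_range_sub (fun n => a (k n)) N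
      _ ≤ u := (sub_le_self _ (ha0 _)).trans (hau _)
  have := h y (fun n => (hy n).trans ((sub_le_self _ (ha0 _)).trans (hau _)))
    (hd0.of_abs_le (.of_forall fun n => by rw [abs_of_nonneg (hd n)]; exact hy n))
  have h1 := (tendsto_zero_iff_norm_tendsto_zero.1 this).eventually (gt_mem_nhds hc)
  obtain ⟨n, hn⟩ := h1.exists
  exact absurd hn (hyc n).not_gt

/-- No sequence in an order interval on which `T` is null is at once bounded below by functionals
dominated by `T` and asymptotically orthogonal to these functionals. -/
theorem not_exists_biorthogonal {u : E} (h : NullOnInterval T u) {x : ℕ → E}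
    (hx0 : ∀ n, 0 ≤ x n) (hxu : ∀ n, x n ≤ u) (φ : ℕ → StrongDual ℝ E) {ε η : ℝ} (hη : 0 < η)
    (hηε : 5 * η < ε) (hmono : ∀ n y z, y ≤ z → φ n y ≤ φ n z)
    (hdom : ∀ n z c, 0 ≤ z → BoundedOnInterval T z c → φ n z ≤ c)
    (hbig : ∀ n, ε ≤ φ n (x n)) (hsmall : ∀ m n, m < n → φ m (x n) ≤ η * (1 / 2) ^ n) : False := by
  have hgeom : ∀ N : ℕ, ∑ n ∈ Finset.range N, η * (1 / 2 : ℝ) ^ n ≤ 2 * η := fun N => by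
    rw [← Finset.mul_sum, mul_comm]
    exact mul_le_mul_of_nonneg_right (sum_geometric_two_le N) hη.le
  -- Padding by 0 below index n makes `W n N` the supremum of x m over n ≤ m ≤ N when n ≤ N.
  let s : ℕ → ℕ → E := fun n m => if n ≤ m then x m else 0
  have hu0 : 0 ≤ u := (hx0 0).trans (hxu 0)
  have hs0 : ∀ n m, 0 ≤ s n m := fun n m => by
    dsimp only [s]
    split_ifs
    exacts [hx0 _, le_rfl]
  have hsu : ∀ n m, s n m ≤ u := fun n m => by
    dsimp only [s]
    split_ifs
    exacts [hxu _, hu0]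
  have hsx : ∀ n m, n ≤ m → s n m = x m := fun n m hnm => if_pos hnm
  have hsanti : ∀ n k m, k ≤ n → s n m ≤ s k m := fun n k m hkn => by
    by_cases hnm : n ≤ m
    · rw [hsx n m hnm, hsx k m (hkn.trans hnm)]
    · exact (if_neg hnm).le.trans (hs0 k m)
  let W : ℕ → ℕ → E := fun n => partialSups (s n)
  have hW0 : ∀ n N, 0 ≤ W n N := fun n N =>
    (hs0 n 0).trans (le_partialSups_of_le (s n) (Nat.zero_le N))
  have hWu : ∀ n N, W n N ≤ u := fun n N => partialSups_le _ _ _ fun m _ => hsu n m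
  have hWmono : ∀ n, Monotone (W n) := fun n => partialSups_monotone _
  have hWanti : ∀ n k N, k ≤ n → W n N ≤ W k N := fun n k N hkn =>
    partialSups_le _ _ _ fun m hm => (hsanti n k m hkn).trans (le_partialSups_of_le (s k) hm)
  have hxW : ∀ n N, n ≤ N → x n ≤ W n N := fun n N hn =>
    (hsx n n le_rfl).ge.trans (le_partialSups_of_le (s n) hn)
  have hφW : ∀ n N, φ n (W (n + 1) N) ≤ 2 * η := fun n N => by
    have hle : W (n + 1) N ≤ ∑ m ∈ Finset.range (N + 1), s (n + 1) m :=
      partialSups_le _ _ _ fun m hm =>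
        Finset.single_le_sum (fun i _ => hs0 (n + 1) i) (Finset.mem_range.2 (by omega))
    refine (hmono n _ _ hle).trans ?_
    rw [map_sum]
    refine le_trans (Finset.sum_le_sum fun m _ => ?_) (hgeom (N + 1))
    dsimp only [s]
    split_ifs with hnm
    · exact hsmall n m hnm
    · rw [map_zero]; positivity
  choose K hK using fun n => h.exists_forall_boundedOnInterval (hW0 n) (hWu n)
    (c := η * (1 / 2) ^ n) (by positivity)
  -- u - W k (K k) increases in k only up to small errors; running suprema restore monotonicity.
  let b : ℕ → E := partialSups fun k => u - W k (K k)
  have hb0 : ∀ n, 0 ≤ b n := fun n =>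
    (sub_nonneg.2 (hWu 0 (K 0))).trans
      (le_partialSups_of_le (fun k => u - W k (K k)) (Nat.zero_le n))
  have hbu : ∀ n, b n ≤ u := fun n => partialSups_le _ _ _ fun k _ => sub_le_self _ (hW0 _ _)
  obtain ⟨n, hn⟩ := h.exists_forall_boundedOnInterval hb0 hbu hη
  let M := (Finset.range (n + 2)).sup K + n
  have hKM : ∀ k ≤ n + 1, K k ≤ M := fun k hk =>
    (Finset.le_sup (f := K) (Finset.mem_range.2 (by omega))).trans (Nat.le_add_right _ _)
  have he0 : ∀ k ≤ n + 1, 0 ≤ W k M - W k (K k) := fun k hk =>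
    sub_nonneg.2 (hWmono k (hKM k hk))
  let e := ∑ k ∈ Finset.range (n + 1), (W k M - W k (K k))
  have he : BoundedOnInterval T e (2 * η) :=
    (BoundedOnInterval.sum (Finset.range (n + 1)) (c := fun k => η * (1 / 2) ^ k)
      (fun k hk => he0 k (by have := Finset.mem_range.1 hk; omega)) fun k hk => hK k M
        (hKM k (by have := Finset.mem_range.1 hk; omega))).mono le_rfl (hgeom _)
  have hen : 0 ≤ e := Finset.sum_nonneg fun k hk =>
    he0 k (by have := Finset.mem_range.1 hk; omega)
  have h1 : b n ≤ u - W n M + e := partialSups_le _ _ _ fun k hk => by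
    have : W k M - W k (K k) ≤ e := Finset.single_le_sum
      (f := fun k => W k M - W k (K k))
      (fun i hi => he0 i (by have := Finset.mem_range.1 hi; omega)) (Finset.mem_range.2 (by omega))
    calc u - W k (K k) = u - W k M + (W k M - W k (K k)) := by abel
      _ ≤ u - W n M + e := add_le_add (sub_le_sub_left (hWanti n k M hk) u) this
  have h2 : u - W (n + 1) M ≤ b (n + 1) :=
    (sub_le_sub_left (hWmono (n + 1) (hKM _ le_rfl)) u).trans
      (le_partialSups (fun k => u - W k (K k)) (n + 1))
  have hbb : 0 ≤ b (n + 1) - b n := sub_nonneg.2 (partialSups_monotone _ (Nat.le_succ n))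
  -- The gap W n M - W (n + 1) M is absorbed by e and one increment of b. Applying φ n gives at most
  -- 2η + 2η + η, whence the 5η in `hηε`.
  have h3 : x n ≤ W (n + 1) M + (e + (b (n + 1) - b n)) := by
    refine (hxW n M (Nat.le_add_left _ _)).trans ?_
    calc W n M = u + e - (u - W n M + e) := by abel
      _ ≤ u + e - b n := sub_le_sub_left h1 _
      _ = W (n + 1) M + (e + ((u - W (n + 1) M) - b n)) := by abel
      _ ≤ _ := by gcongr
  have h4 := hmono n _ _ h3
  rw [map_add] at h4
  have h5 := hdom n _ _ (add_nonneg hen hbb) (he.add hen hbb (hn (n + 1) (Nat.le_succ n)))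
  have h6 := hφW n M
  have h7 := hbig n
  linarith

/-- If `T` maps uaw-null sequences of `[-u, u]` to norm-null sequences, then it does so for nets
of `[0, u]` which are null for all continuous functionals. -/
theorem tendsto_of_weakly_null {u : E} (h : NullOnInterval T u) {ι : Type*} {l : Filter ι}
    {x : ι → E} (hx0 : ∀ i, 0 ≤ x i) (hxu : ∀ i, x i ≤ u)
    (hx : ∀ f : StrongDual ℝ E, Tendsto (fun i => f (x i)) l (𝓝 0)) :
    Tendsto (fun i => T (x i)) l (𝓝 0) := by
  by_contra hcon
  rw [tendsto_zero_iff_norm_tendsto_zero, Metric.tendsto_nhds] at hcon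
  push Not at hcon
  obtain ⟨ε, hε, hfreq⟩ := hcon
  -- g is the modulus of f ∘ T, where f has norm at most 1 and norms T y.
  have hex : ∀ y : E, ∃ g : StrongDual ℝ E, (∀ y z, y ≤ z → g y ≤ g z) ∧
      (∀ z c, 0 ≤ z → BoundedOnInterval T z c → g z ≤ c) ∧ (0 ≤ y → ‖T y‖ ≤ g y) := fun y => by
    obtain ⟨f, hf1, hf2⟩ := exists_dual_vector'' ℝ (T y)
    obtain ⟨g, hg1, hg2⟩ := exists_modulus (f.comp T)
    refine ⟨g, fun y z hyz => mono_of_forall_abs_le hg1 hyz, fun z c hz hzc => ?_, fun hy => ?_⟩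
    · refine hg2 z c hz fun v hv => ?_
      refine ((le_abs_self _).trans (f.le_opNorm (T v))).trans ?_
      exact (mul_le_of_le_one_left (norm_nonneg _) hf1).trans (hzc v hv)
    · have := hg1 y y (abs_of_nonneg hy).le
      refine le_trans (le_of_eq ?_) ((le_abs_self _).trans this)
      simpa using hf2.symm
  choose φ hmono hdom hbig using hex
  let η := ε / 6
  have hη : 0 < η := by positivity
  -- The number stored with each point strictly increases, so it is at least the point's position
  -- and the bounds decay geometrically.
  obtain ⟨s, hs1, hs2⟩ := exists_seq_of_forall_finset_exists
    (fun p : ℕ × E => 0 ≤ p.2 ∧ p.2 ≤ u ∧ ε ≤ ‖T p.2‖)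
    (fun p q => p.1 < q.1 ∧ φ p.2 q.2 ≤ η * (1 / 2) ^ q.1) fun s _ => by
      let n := s.sup Prod.fst + 1
      have hev : ∀ᶠ i in l, ∀ p ∈ s, φ p.2 (x i) ≤ η * (1 / 2) ^ n :=
        (Finset.eventually_all s).2 fun p _ =>
          ((hx (φ p.2)).eventually (gt_mem_nhds (by positivity : 0 < η * (1 / 2) ^ n))).mono
            fun _ hi => hi.le
      obtain ⟨i, hi1, hi2⟩ := (hfreq.and_eventually hev).exists
      refine ⟨(n, x i), ⟨hx0 i, hxu i, by simpa using hi1⟩, fun p hp => ⟨?_, hi2 p hp⟩⟩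
      exact Nat.lt_succ_of_le (Finset.le_sup (f := Prod.fst) hp)
  have hsm : StrictMono fun n => (s n).1 := fun m n hmn => (hs2 m n hmn).1
  refine h.not_exists_biorthogonal (x := fun n => (s n).2) (fun n => (hs1 n).1)
    (fun n => (hs1 n).2.1) (fun n => φ (s n).2) hη (ε := ε) (by simp only [η]; linarith)
    (fun n => hmono _) (fun n => hdom _) (fun n => (hs1 n).2.2.trans (hbig _ (hs1 n).1))
    fun m n hmn => (hs2 m n hmn).2.trans ?_
  refine mul_le_mul_of_nonneg_left ?_ hη.le
  exact pow_le_pow_of_le_one (by norm_num) (by norm_num) (hsm.id_le n)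

end NullOnInterval

end NullOnInterval

/-! ### A disjointness criterion for positive parts. -/

section Disjoint

variable {E : Type*} [NormedAddCommGroup E] [NormedSpace ℝ E] [Lattice E]
  [IsOrderedAddMonoid E] [IsOrderedModule ℝ E]

omit [NormedSpace ℝ E] [IsOrderedModule ℝ E] in
theorem nsmul_inf_eq_zero {a b : E} (ha : 0 ≤ a) (hb : 0 ≤ b) (h : a ⊓ b = 0) (k : ℕ) :
    k • a ⊓ b = 0 := by
  induction k with
  | zero => simpa using hb
  | succ k ih =>
    have hka := nsmul_nonneg ha k
    refine le_antisymm ?_ (le_inf (nsmul_nonneg ha _) hb)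
    rw [succ_nsmul]
    exact (inf_add_le_add_inf hka ha hb).trans (by rw [ih, h, add_zero])

/-- Where a exceeds k b, b is below r a: the first factor is dominated by a multiple of the negative
part of b - r a. -/
theorem posPart_sub_nsmul_inf_posPart_sub_smul {a b : E} (ha : 0 ≤ a) (k : ℕ) {r : ℝ}
    (h : 1 ≤ k * r) : (a - k • b)⁺ ⊓ (b - r • a)⁺ = 0 := by
  have h1 : a - k • b ≤ k • (b - r • a)⁻ := by
    calc a - k • b ≤ (k * r : ℝ) • a - k • b :=
          sub_le_sub_right (by simpa using smul_le_smul_of_nonneg_right h ha) _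
      _ = k • (-(b - r • a)) := by
          rw [mul_smul, Nat.cast_smul_eq_nsmul, neg_sub, nsmul_sub]
      _ ≤ _ := nsmul_le_nsmul_right (neg_le_negPart _) k
  have h2 : (a - k • b)⁺ ≤ k • (b - r • a)⁻ := sup_le h1 (nsmul_nonneg (negPart_nonneg _) k)
  refine le_antisymm ((inf_le_inf_right _ h2).trans ?_)
    (le_inf (posPart_nonneg _) (posPart_nonneg _))
  refine (nsmul_inf_eq_zero (negPart_nonneg _) (posPart_nonneg _) ?_ k).le
  rw [inf_comm]
  exact posPart_inf_negPart_eq_zero _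

end Disjoint

/-! ### Consequences of L-weak compactness on a solid hull. -/

section LWeaklyCompact

variable {E F : Type*} [NormedAddCommGroup E] [NormedSpace ℝ E] [Lattice E]
  [IsOrderedAddMonoid E] [HasSolidNorm E] [NormedAddCommGroup F] [NormedSpace ℝ F]

open LatticeOrderedAddCommGroup

omit [NormedSpace ℝ E] [IsOrderedAddMonoid E] [HasSolidNorm E] in
theorem mem_solidClosure_of_abs_le {S : Set E} {x y : E} (hx : x ∈ solidClosure S)
    (h : |y| ≤ |x|) : y ∈ solidClosure S := isSolid_solidClosure S hx h

omit [NormedSpace ℝ E] [IsOrderedAddMonoid E] in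
theorem exists_norm_le_of_mem_solidClosure {S : Set E} (hS : Bornology.IsBounded S) :
    ∃ C, ∀ x ∈ solidClosure S, ‖x‖ ≤ C := by
  obtain ⟨C, hC⟩ := hS.exists_norm_le
  exact ⟨C, fun x ⟨s, hs, hxs⟩ => (norm_le_norm_of_abs_le_abs hxs).trans (hC s hs)⟩

omit [NormedSpace ℝ E] [HasSolidNorm E] in
theorem abs_posPart_le_abs (x : E) : |x⁺| ≤ |x| := by
  rw [abs_of_nonneg (posPart_nonneg x)]
  exact sup_le (le_abs_self x) (abs_nonneg x)

omit [NormedSpace ℝ E] [HasSolidNorm E] in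
theorem abs_negPart_le_abs (x : E) : |x⁻| ≤ |x| := by
  rw [abs_of_nonneg (negPart_nonneg x)]
  exact sup_le (neg_le_abs x) (abs_nonneg x)

namespace IsLWeaklyCompactOn

variable {S : Set E} {T : E →L[ℝ] F}

omit [IsOrderedAddMonoid E] [HasSolidNorm E] in
theorem nullOnInterval (h : IsLWeaklyCompactOn S T) {x : E}
    (hx : x ∈ solidClosure S) : NullOnInterval T x := fun y hy hy0 =>
  h y (fun n => mem_solidClosure_of_abs_le hx ((hy n).trans (le_abs_self x))) hy0

/-- Up to a small error, `T` only sees the part of the solid hull below a suitable `u`. -/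
theorem exists_norm_map_posPart_sub_le [CompleteSpace E] [IsOrderedModule ℝ E]
    (hS : Bornology.IsBounded S) (h : IsLWeaklyCompactOn S T) {ε : ℝ} (hε : 0 < ε) :
    ∃ u, 0 ≤ u ∧ NullOnInterval T u ∧
      ∀ x ∈ solidClosure S, 0 ≤ x → ‖T (x - u)⁺‖ ≤ ε := by
  by_contra! hcon
  choose! X hXS hX0 hXT using hcon
  -- s n is the sum of the earlier x m, and x n is a counterexample to the level u = 4 ^ n • s n.
  let s : ℕ → E := fun n => Nat.rec 0 (fun k v => v + X (4 ^ k • v)) n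
  let x : ℕ → E := fun n => X (4 ^ n • s n)
  have hs : ∀ n, s (n + 1) = s n + x n := fun n => rfl
  have hgood : ∀ n, 0 ≤ s n ∧ NullOnInterval T (s n) := fun n => by
    induction n with
    | zero =>
      refine ⟨le_rfl, ?_⟩
      change NullOnInterval T 0
      simpa using NullOnInterval.nsmul (T := T) (u := 0) le_rfl (fun y hy _ => by
        have : ∀ n, T (y n) = 0 := fun n =>
          norm_le_zero_iff.1 (BoundedOnInterval.zero (T := T) (y n) (hy n))
        simp [this]) 0
    | succ n ih =>
      have h1 := nsmul_nonneg ih.1 (4 ^ n)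
      have h2 := ih.2.nsmul ih.1 (4 ^ n)
      have h3 : 0 ≤ x n := hX0 _ h1 h2
      rw [hs]
      exact ⟨add_nonneg ih.1 h3, ih.2.add ih.1 h3 (h.nullOnInterval (hXS _ h1 h2))⟩
  have hg0 := fun n => nsmul_nonneg (hgood n).1 (4 ^ n)
  have hg1 := fun n => (hgood n).2.nsmul (hgood n).1 (4 ^ n)
  have hxS : ∀ n, x n ∈ solidClosure S := fun n => hXS _ (hg0 n) (hg1 n)
  have hx0 : ∀ n, 0 ≤ x n := fun n => hX0 _ (hg0 n) (hg1 n)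
  have hxT : ∀ n, ε < ‖T (x n - 4 ^ n • s n)⁺‖ := fun n => hXT _ (hg0 n) (hg1 n)
  have hsmono : Monotone s := monotone_nat_of_le_succ fun n => by
    rw [hs]; exact le_add_of_nonneg_right (hx0 n)
  have hxs : ∀ m n, m < n → x m ≤ s n := fun m n hmn =>
    le_trans (by rw [hs]; exact le_add_of_nonneg_left (hgood m).1) (hsmono hmn)
  obtain ⟨C, hC⟩ := exists_norm_le_of_mem_solidClosure hS
  have hsum : Summable fun n => (1 / 2 : ℝ) ^ n • x n := by
    refine Summable.of_norm_bounded (g := fun n => (1 / 2 : ℝ) ^ n * C)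
      (summable_geometric_two.mul_right C) fun n => ?_
    rw [norm_smul, norm_pow]
    norm_num
    exact hC _ (hxS n)
  have hterm : ∀ n, 0 ≤ (1 / 2 : ℝ) ^ n • x n := fun n => smul_nonneg (by positivity) (hx0 n)
  let w := ∑' n, (1 / 2 : ℝ) ^ n • x n
  have hw0 : 0 ≤ w := tsum_nonneg hterm
  have hxw : ∀ n, (1 / 2 : ℝ) ^ n • x n ≤ w := fun n => hsum.le_tsum n fun j _ => hterm j
  -- Subtracting 2⁻ⁿ w changes little in norm and forces disjointness: for m < n, y n ≤ (x n - 4ⁿ x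
  -- m)⁺ and y m ≤ (x m - 2⁻⁽ᵐ⁺ⁿ⁾ x n)⁺, while 4ⁿ ≥ 2ᵐ⁺ⁿ.
  let y : ℕ → E := fun n => (x n - 4 ^ n • s n - (1 / 2 : ℝ) ^ n • w)⁺
  have hy0 : ∀ n, 0 ≤ y n := fun n => posPart_nonneg _
  have hyx : ∀ n, y n ≤ x n := fun n => by
    refine sup_le ((sub_le_self _ ?_).trans (sub_le_self _ (hg0 n))) (hx0 n)
    exact smul_nonneg (by positivity) hw0
  have hyS : ∀ n, y n ∈ solidClosure S := fun n => by
    refine mem_solidClosure_of_abs_le (hxS n) ?_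
    rw [abs_of_nonneg (hy0 n), abs_of_nonneg (hx0 n)]
    exact hyx n
  have hdisj : ∀ m n, m < n → y m ⊓ y n = 0 := fun m n hmn => by
    refine le_antisymm ?_ (le_inf (hy0 m) (hy0 n))
    have hr : (1 : ℝ) ≤ ((4 ^ n : ℕ) : ℝ) * (1 / 2) ^ (m + n) := by
      have e : ((4 ^ n : ℕ) : ℝ) = 2 ^ (n + n) := by
        push_cast
        rw [← two_mul, pow_mul]; norm_num
      rw [e, one_div, inv_pow, ← div_eq_mul_inv, one_le_div (by positivity)]
      exact pow_le_pow_right₀ (by norm_num) (by omega)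
    rw [← posPart_sub_nsmul_inf_posPart_sub_smul (b := x m) (hx0 n) (4 ^ n) hr, inf_comm (y m)]
    refine inf_le_inf (posPart_mono ?_) (posPart_mono ?_)
    · refine (sub_le_self _ (smul_nonneg (by positivity) hw0)).trans (sub_le_sub_left ?_ _)
      exact nsmul_le_nsmul_right (hxs m n hmn) _
    · rw [pow_add, mul_smul]
      refine sub_le_sub (sub_le_self _ (hg0 m)) ?_
      exact smul_le_smul_of_nonneg_left (hxw n) (by positivity)
  have hyu : UawTendsto y atTop 0 := uawTendsto_zero_of_sum_inf_le hy0 fun v hv =>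
    ⟨v, sum_inf_le_of_pairwise_inf_eq_zero hy0 hdisj hv⟩
  have hTy := h y hyS hyu
  have hdiff : Tendsto (fun n => (x n - 4 ^ n • s n)⁺ - y n) atTop (𝓝 0) := by
    have hlim : Tendsto (fun n : ℕ => ‖(1 / 2 : ℝ) ^ n • w‖) atTop (𝓝 0) := by
      have := (tendsto_pow_atTop_nhds_zero_of_lt_one (r := (1 / 2 : ℝ)) (by norm_num)
        (by norm_num)).smul_const w
      rw [zero_smul] at this
      exact tendsto_zero_iff_norm_tendsto_zero.1 this
    refine squeeze_zero_norm (fun n => ?_) hlim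
    refine (norm_sup_sub_sup_le_norm _ _ _).trans (le_of_eq ?_)
    rw [sub_sub_cancel]
  have hTz := ((T.continuous.tendsto' 0 0 (map_zero T)).comp hdiff).add hTy
  have hTz' : Tendsto (fun n => T (x n - 4 ^ n • s n)⁺) atTop (𝓝 0) := by
    simpa [Function.comp_def] using hTz
  obtain ⟨n, hn⟩ :=
    ((tendsto_zero_iff_norm_tendsto_zero.1 hTz').eventually (gt_mem_nhds hε)).exists
  exact absurd hn (hxT n).not_gt

variable [CompleteSpace E] [IsOrderedModule ℝ E]

theorem tendsto_of_nonneg (hS : Bornology.IsBounded S) (h : IsLWeaklyCompactOn S T) {ι : Type*}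
    {l : Filter ι} {x : ι → E} (hxS : ∀ᶠ i in l, x i ∈ solidClosure S) (hx0 : ∀ i, 0 ≤ x i)
    (hx : UawTendsto x l 0) : Tendsto (fun i => T (x i)) l (𝓝 0) := by
  rw [tendsto_zero_iff_norm_tendsto_zero, Metric.tendsto_nhds]
  intro ε hε
  obtain ⟨u, hu0, hu, huT⟩ := h.exists_norm_map_posPart_sub_le hS (half_pos hε)
  have h1 : Tendsto (fun i => T (x i ⊓ u)) l (𝓝 0) := by
    refine hu.tendsto_of_weakly_null (fun i => le_inf (hx0 i) hu0) (fun i => inf_le_right)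
      fun f => ?_
    have := hx u hu0 f
    simpa [abs_of_nonneg (hx0 _)] using this
  filter_upwards [hxS, (tendsto_zero_iff_norm_tendsto_zero.1 h1).eventually
    (gt_mem_nhds (half_pos hε))] with i hi1 hi2
  have e : x i = (x i - u)⁺ + x i ⊓ u := by rw [inf_eq_sub_posPart_sub]; abel
  have h2 := huT (x i) hi1 (hx0 i)
  rw [dist_zero_right, norm_norm]
  calc ‖T (x i)‖ = ‖T (x i - u)⁺ + T (x i ⊓ u)‖ := by rw [← map_add, ← e]
    _ ≤ ‖T (x i - u)⁺‖ + ‖T (x i ⊓ u)‖ := norm_add_le _ _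
    _ < ε := by linarith

/-- `S`-L-weakly compact operators map uaw-null nets in the solid hull to norm-null nets. -/
theorem tendsto_of_uawTendsto_zero (hS : Bornology.IsBounded S) (h : IsLWeaklyCompactOn S T)
    {ι : Type*} {l : Filter ι} {x : ι → E} (hxS : ∀ᶠ i in l, x i ∈ solidClosure S)
    (hx : UawTendsto x l 0) : Tendsto (fun i => T (x i)) l (𝓝 0) := by
  have h1 := h.tendsto_of_nonneg hS (x := fun i => (x i)⁺)
    (hxS.mono fun i hi => mem_solidClosure_of_abs_le hi (abs_posPart_le_abs _))
    (fun i => posPart_nonneg _) (hx.of_abs_le (.of_forall fun i => abs_posPart_le_abs _))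
  have h2 := h.tendsto_of_nonneg hS (x := fun i => (x i)⁻)
    (hxS.mono fun i hi => mem_solidClosure_of_abs_le hi (abs_negPart_le_abs _))
    (fun i => negPart_nonneg _) (hx.of_abs_le (.of_forall fun i => abs_negPart_le_abs _))
  simpa [← map_sub] using h1.sub h2

/-- Differences may leave the solid hull; Riesz decomposition splits each into two pieces that stay
in it and remain below |x i - y i|. -/
theorem tendsto_sub_of_uawTendsto_zero (hS : Bornology.IsBounded S) (h : IsLWeaklyCompactOn S T)
    {ι : Type*} {l : Filter ι} {x y : ι → E} (hxS : ∀ᶠ i in l, x i ∈ solidClosure S)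
    (hyS : ∀ᶠ i in l, y i ∈ solidClosure S) (hxy : UawTendsto (fun i => x i - y i) l 0) :
    Tendsto (fun i => T (x i) - T (y i)) l (𝓝 0) := by
  have hle : ∀ i, |x i - y i| ≤ |x i| + |y i| := fun i => by
    rw [sub_eq_add_neg, ← abs_neg (y i)]
    exact abs_add_le _ _
  choose a b hab ha hb ha' hb' using fun i =>
    exists_add_eq_of_abs_le_add (abs_nonneg (x i)) (abs_nonneg (y i)) (hle i)
  have h1 := h.tendsto_of_uawTendsto_zero hS
    (hxS.mono fun i hi => mem_solidClosure_of_abs_le hi (ha i)) (hxy.of_abs_le (.of_forall ha'))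
  have h2 := h.tendsto_of_uawTendsto_zero hS
    (hyS.mono fun i hi => mem_solidClosure_of_abs_le hi (hb i)) (hxy.of_abs_le (.of_forall hb'))
  simpa only [← map_add, hab, map_sub, add_zero] using h1.add h2

/-- The image of a uaw-convergent filter on the solid hull is a Cauchy filter. -/
theorem cauchy_map (hS : Bornology.IsBounded S) (h : IsLWeaklyCompactOn S T) {l : Filter E}
    [l.NeBot] (hl : ∀ᶠ x in l, x ∈ solidClosure S) {a : E}
    (ha : UawTendsto (fun x => x) l a) : Cauchy (map T l) := by
  -- The limit a may lie outside the solid hull, so pairs of points are compared instead.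
  have h1 := ha.sub_const.comp (tendsto_fst (f := l) (g := l))
  have h2 := (ha.sub_const.comp (tendsto_snd (f := l) (g := l))).neg
  have h3 : UawTendsto (fun p : E × E => p.1 - p.2) (l ×ˢ l) 0 := by
    simpa only [neg_sub, sub_add_sub_cancel] using h1.add h2
  have h4 := h.tendsto_sub_of_uawTendsto_zero hS (tendsto_fst.eventually hl)
    (tendsto_snd.eventually hl) h3
  refine ⟨inferInstance, ?_⟩
  rw [prod_map_map_eq, uniformity_eq_comap_nhds_zero, ← tendsto_iff_comap, tendsto_map'_iff]
  simpa [Function.comp_def] using h4.neg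

theorem isCompact_closure_image [CompleteSpace F] (hS : Bornology.IsBounded S)
    (h : IsLWeaklyCompactOn S T) {A : Set E} (hAS : A ⊆ solidClosure S)
    (hA : IsRelUawCompact A) : IsCompact (closure (T '' A)) := by
  have htb : TotallyBounded (T '' A) := by
    rw [totallyBounded_iff_filter]
    intro f hf hfA
    have hne : (comap T f ⊓ 𝓟 A).NeBot := by
      rw [← map_neBot_iff T, Filter.push_pull', map_principal]
      rwa [inf_eq_left.2 hfA]
    obtain ⟨l, hl, hlA, a, ha⟩ := hA.2 _ hne inf_le_right
    refine ⟨map T l, (map_mono (hlA.trans inf_le_left)).trans map_comap_le, ?_⟩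
    exact h.cauchy_map hS (mem_of_superset ((hlA.trans inf_le_right) (mem_principal_self A)) hAS) ha
  exact htb.closure.isCompact_of_isClosed isClosed_closure

theorem isCompact_image (hS : Bornology.IsBounded S) (h : IsLWeaklyCompactOn S T) {A : Set E}
    (hAS : A ⊆ solidClosure S) (hA : IsUawCompact A) : IsCompact (T '' A) := by
  intro f hf hfA
  have hne : (comap T f ⊓ 𝓟 A).NeBot := by
    rw [← map_neBot_iff T, Filter.push_pull', map_principal]
    rwa [inf_eq_left.2 hfA]
  obtain ⟨l, hl, hlA, a, haA, ha⟩ := hA.2 _ hne inf_le_right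
  have hlS : ∀ᶠ x in l, x ∈ solidClosure S :=
    mem_of_superset ((hlA.trans inf_le_right) (mem_principal_self A)) hAS
  refine ⟨T a, Set.mem_image_of_mem T haA, ?_⟩
  have h1 := h.tendsto_sub_of_uawTendsto_zero hS hlS (.of_forall fun _ => hAS haA) ha.sub_const
  have h2 : Tendsto T l (𝓝 (T a)) := tendsto_sub_nhds_zero_iff.1 h1
  have h3 : Tendsto T l f := (map_mono (hlA.trans inf_le_left)).trans map_comap_le
  exact (hl.map T).mono (le_inf h2 h3)

end IsLWeaklyCompactOn

/-! ### From compactness back to sequences. -/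

omit [HasSolidNorm E] in
/-- The range of a uaw-null sequence together with its limit is uaw-compact. -/
theorem isUawCompact_insert_zero_range {x : ℕ → E} (hx : UawTendsto x atTop 0)
    (hb : Bornology.IsBounded (Set.range x)) : IsUawCompact (insert 0 (Set.range x)) := by
  refine ⟨hb.insert 0, fun l hl hlA => ?_⟩
  obtain ⟨l', hl'⟩ := exists_ultrafilter_le l
  refine ⟨l', l'.neBot, hl', ?_⟩
  have hmem : insert 0 (Set.range x) ∈ l' := hl'.trans hlA (mem_principal_self _)
  by_cases hp : ∃ a ∈ insert 0 (Set.range x), {a} ∈ l'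
  · obtain ⟨a, haA, ha⟩ := hp
    refine ⟨a, haA, fun u hu f => tendsto_const_nhds.congr' ?_⟩
    filter_upwards [ha] with z hz
    rw [Set.mem_singleton_iff.1 hz, sub_self, abs_zero, inf_eq_left.2 hu, map_zero]
  · push Not at hp
    refine ⟨0, Set.mem_insert _ _, ?_⟩
    -- A nonprincipal ultrafilter contains no finite set, so discarding 0 and finitely many terms
    -- leaves tails.
    have hle : (l' : Filter E) ≤ map x atTop := by
      intro U hU
      obtain ⟨N, hN⟩ := mem_atTop_sets.1 hU
      have hfin : (insert 0 (x '' Set.Iio N)).Finite := ((Set.finite_Iio N).image x).insert 0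
      have hnot : (insert 0 (x '' Set.Iio N)) ∉ l' := fun hm => by
        obtain ⟨a, ha, hal⟩ := (Ultrafilter.eq_pure_of_finite_mem hfin hm)
        refine hp a (Set.insert_subset_insert (Set.image_subset_range _ _) ha) ?_
        rw [hal]; exact mem_pure.2 rfl
      filter_upwards [hmem, Ultrafilter.compl_mem_iff_notMem.2 hnot] with z hz hz'
      rcases hz with rfl | ⟨n, rfl⟩
      · exact absurd (Set.mem_insert _ _) hz'
      · refine hN n (not_lt.1 fun hn => hz' (Set.mem_insert_of_mem _ ⟨n, hn, rfl⟩))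
    exact fun u hu f => (show Tendsto _ (map x atTop) _ from hx u hu f).mono_left hle

omit [IsOrderedAddMonoid E] [HasSolidNorm E] in
theorem IsUawCompact.isRelUawCompact {A : Set E} (hA : IsUawCompact A) : IsRelUawCompact A :=
  ⟨hA.1, fun l hl hlA =>
    let ⟨l', h1, h2, a, _, h3⟩ := hA.2 l hl hlA
    ⟨l', h1, h2, a, h3⟩⟩

/-- A uaw-continuous operator is `S`-L-weakly compact if it maps uaw-compact subsets of the solid
hull into norm compact sets. -/
theorem IsLWeaklyCompactOn.of_isCompact_closure {G : Type*} [NormedAddCommGroup G]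
    [NormedSpace ℝ G] [Lattice G] [IsOrderedAddMonoid G] [HasSolidNorm G] {S : Set E}
    (hS : Bornology.IsBounded S) {T : E →L[ℝ] G} (hT : UawContinuous T)
    (h : ∀ A : Set E, A ⊆ solidClosure S → IsUawCompact A → IsCompact (closure (T '' A))) :
    IsLWeaklyCompactOn S T := by
  intro x hxS hx
  have hb : Bornology.IsBounded (Set.range x) := by
    obtain ⟨C, hC⟩ := exists_norm_le_of_mem_solidClosure hS
    refine isBounded_iff_forall_norm_le.2 ⟨C, ?_⟩
    rintro _ ⟨n, rfl⟩
    exact hC _ (hxS n)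
  have hAS : insert 0 (Set.range x) ⊆ solidClosure S := by
    refine Set.insert_subset ?_ (Set.range_subset_iff.2 hxS)
    exact mem_solidClosure_of_abs_le (hxS 0) (by simp)
  have hK := h _ hAS (isUawCompact_insert_zero_range hx hb)
  have hTx : UawTendsto (fun n => T (x n)) atTop 0 := by
    have := hT (map x atTop) 0 hx
    rw [map_zero] at this
    exact this
  -- In a compact set, a sequence whose only cluster point is 0 converges to 0.
  refine hK.tendsto_nhds_of_unique_mapClusterPt (.of_forall fun n => subset_closure
    (Set.mem_image_of_mem T (Set.mem_insert_of_mem _ (Set.mem_range_self n)))) fun b _ hbc => ?_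
  obtain ⟨φ, hφ, hlim⟩ := hbc.tendsto_subseq
  exact (hTx.comp hφ.tendsto_atTop).eq_zero_of_tendsto hlim

end LWeaklyCompact

theorem proposition3p9
    {E F : Type*}
    [NormedAddCommGroup E] [NormedSpace ℝ E] [CompleteSpace E]
    [Lattice E] [IsOrderedAddMonoid E] [IsOrderedModule ℝ E] [HasSolidNorm E]
    [NormedAddCommGroup F] [NormedSpace ℝ F] [CompleteSpace F]
    [Lattice F] [IsOrderedAddMonoid F] [IsOrderedModule ℝ F] [HasSolidNorm F]
    (S : Set E) (hS : Bornology.IsBounded S) (T : E →L[ℝ] F) :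
    (UawContinuous T →
      List.TFAE [
        IsLWeaklyCompactOn S T,
        ∀ A : Set E, A ⊆ LatticeOrderedAddCommGroup.solidClosure S →
          IsRelUawCompact A → IsCompact (closure (T '' A)),
        ∀ A : Set E, A ⊆ LatticeOrderedAddCommGroup.solidClosure S →
          IsUawCompact A → IsCompact (T '' A)]) ∧
    (IsLWeaklyCompactOn S T →
      (∀ A : Set E, A ⊆ LatticeOrderedAddCommGroup.solidClosure S →
        IsRelUawCompact A → IsCompact (closure (T '' A))) ∧
      (∀ A : Set E, A ⊆ LatticeOrderedAddCommGroup.solidClosure S →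
        IsUawCompact A → IsCompact (T '' A))) := by
  have key : IsLWeaklyCompactOn S T →
      (∀ A : Set E, A ⊆ LatticeOrderedAddCommGroup.solidClosure S →
        IsRelUawCompact A → IsCompact (closure (T '' A))) ∧
      (∀ A : Set E, A ⊆ LatticeOrderedAddCommGroup.solidClosure S →
        IsUawCompact A → IsCompact (T '' A)) := fun h =>
    ⟨fun _ hAS hA => h.isCompact_closure_image hS hAS hA,
      fun _ hAS hA => h.isCompact_image hS hAS hA⟩
  refine ⟨fun hT => ?_, key⟩
  tfae_have 1 → 2 := fun h => (key h).1
  tfae_have 1 → 3 := fun h => (key h).2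
  tfae_have 2 → 1 := fun h => .of_isCompact_closure hS hT fun A hAS hA =>
    h A hAS hA.isRelUawCompact
  tfae_have 3 → 1 := fun h => .of_isCompact_closure hS hT fun A hAS hA =>
    (h A hAS hA).closure
  tfae_finish
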